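/- **Theorem 3.4.** Let $E$ be a Polish space with its Borel $\sigma$-field, let $\alpha$ be a probability measure on $E$, and let $X_1,X_2,\dots$ be i.i.d. $E$-valued random variables with law $\alpha$, with empirical measures $L_n=\frac1n\sum_{i=1}^n\delta_{X_i}$. Let $(B,\|\cdot\|)$ be a real separable Banach space with dual $B'$, and assume that $B$ is of type 2 with constant $a>0$, i.e. for every sequence $(Z_i)$ of square integrable, centered, i.i.d. $B$-valued random variables with $\mathbb E\|Z_i\|^2=1$ and every $n$, $$\mathbb E\Big\|\sum_{i=1}^nZ_i\Big\|^2\le a\sum_{i=1}^n\mathbb E\|Z_i\|^2 .$$ Let $F:E\to B$ be measurable with $\int e^{s\|F\|}\,d\alpha<\infty$ for some $s>0$. For $\lambda\in B'$ put $Z_F(\lambda)=\int e^{\langle\lambda,F\rangle}\,d\alpha\in(0,\infty]$ and $\Lambda_F(\lambda)=\log Z_F(\lambda)$, and assume that $\{\lambda\in B':\Lambda_F(\lambda)<\infty\}$ is a non-empty open subset of $B'$. Let $K\subseteq B$ be non-empty, closed and convex, and assume (H-K) the function $H(\lambda)=\Lambda_F(\lambda)-\inf_{y\in K}\langle\lambda,y\rangle$,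 with values in $(-\infty,+\infty]$, attains its minimum over $B'$ at some $\lambda^*$. For a closed set $K'\subseteq B$ let $C(K')$ be the set of all probability measures $\nu$ on $E$ such that $F$ is Bochner integrable with respect to $\nu$ and $\int F\,d\nu\in K'$. Set $$\alpha^*=\frac{e^{\langle\lambda^*,F\rangle}}{Z_F(\lambda^*)}\,\alpha .$$ Then $\alpha^*$ is the $I$-projection of $\alpha$ on $C(K)$, i.e. $\alpha^*\in C(K)$, its relative entropy with respect to $\alpha$ is finite, and it is the unique minimizer over $\nu\in C(K)$ of the relative entropy of $\nu$ with respect to $\alpha$. Moreover, put $c=\sqrt{a\,\mathrm{Var}_{\alpha^*}(F)}$, where $\mathrm{Var}_{\alpha^*}(F)=\int\|F-\int F\,d\alpha^*\|^2\,d\alpha^*$, let $(\varepsilon_n)_{n\ge1}$ be any sequence with $\varepsilon_n\to0$ and $\varepsilon_n>c/\sqrt n$ for all $n\ge1$, and let $K^{\varepsilon_n}=\{x\in B: d(x,K)\le\varepsilon_n\}$ and $C_n=C(K^{\varepsilon_n})$. Then $\mathbb P(L_n\in C_n)>0$ for all large $n$ and, for every $k\ge1$, the conditional law $$\alpha^n_{C_n,k}=\mathcal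 L\big((X_1,\dots,X_k)\,\big|\,L_n\in C_n\big)$$ converges in total variation distance to $\alpha^{*\otimes k}$ as $n\to\infty$. -/

import Mathlib

open MeasureTheory ProbabilityTheory Filter Topology
open scoped ENNReal

universe u v

noncomputable section

/-- A real normed space `B` is of type 2 with constant `a > 0`: for every sequence of square
integrable, centered, i.i.d. `B`-valued random variables with variance one and every `n`,
`E ‖Z₀ + ... + Z_{n-1}‖² ≤ a ∑ E ‖Z_i‖²`. -/
def IsTypeTwoWith (B : Type v) [NormedAddCommGroup B] [NormedSpace ℝ B]
    [MeasurableSpace B] [BorelSpace B] (a : ℝ) : Prop :=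
  0 < a ∧
    ∀ (Ω : Type v) [MeasurableSpace Ω] (P : Measure Ω) [IsProbabilityMeasure P]
      (Z : ℕ → Ω → B),
      (∀ i, Measurable (Z i)) → (∀ i, MemLp (Z i) 2 P) → iIndepFun Z P →
      (∀ i, P.map (Z i) = P.map (Z 0)) →
      (∀ i, ∫ ω, Z i ω ∂P = 0) → (∀ i, ∫ ω, ‖Z i ω‖ ^ 2 ∂P = 1) →
      ∀ n : ℕ, ∫ ω, ‖∑ i ∈ Finset.range n, Z i ω‖ ^ 2 ∂P ≤
        a * ∑ i ∈ Finset.range n, ∫ ω, ‖Z i ω‖ ^ 2 ∂P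

section Constraint

variable {E : Type u} [MeasurableSpace E] {B : Type v} [NormedAddCommGroup B] [NormedSpace ℝ B]

/-- The space `L_τ(α)` of measurable functions with some finite exponential moment. -/
def MemLtau (α : Measure E) (g : E → ℝ) : Prop :=
  Measurable g ∧ ∃ s : ℝ, 0 < s ∧ ∫⁻ x, ENNReal.ofReal (Real.exp (s * |g x|)) ∂α < ⊤

/-- The Laplace transform `Z_F(lam) = ∫ exp ⟨lam, F⟩ dα ∈ [0, ∞]`. -/
def laplaceTransform (α : Measure E) (F : E → B) (lam : StrongDual ℝ B) : ℝ≥0∞ :=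
  ∫⁻ x, ENNReal.ofReal (Real.exp (lam (F x))) ∂α

/-- The log-Laplace transform `Λ_F(lam) = log Z_F(lam)`, with values in the extended reals. -/
def logLaplace (α : Measure E) (F : E → B) (lam : StrongDual ℝ B) : EReal :=
  ENNReal.log (laplaceTransform α F lam)

/-- `dom Λ_F`, a subset of the dual space (with its norm topology). -/
def domLogLaplace (α : Measure E) (F : E → B) : Set (StrongDual ℝ B) :=
  {lam | logLaplace α F lam < ⊤}

/-- `H(lam) = Λ_F(lam) - inf_{y ∈ K} ⟨lam, y⟩`. For a nonempty `K` and a probability measure `α`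
the infimum is not `+∞` and `Λ_F` is not `-∞`, so that no undefined difference occurs. -/
def dualFunctional (α : Measure E) (F : E → B) (K : Set B) (lam : StrongDual ℝ B) : EReal :=
  logLaplace α F lam - ⨅ y ∈ K, ((lam y : ℝ) : EReal)

/-- The probability measures `ν` for which `∫ F dν` exists as a Bochner integral and lies
in `K`. -/
def momentConstraint (F : E → B) (K : Set B) : Set (Measure E) :=
  {ν | IsProbabilityMeasure ν ∧ Integrable F ν ∧ ∫ x, F x ∂ν ∈ K}

/-- `Var_ν(F) = ∫ ‖F - ∫ F dν‖² dν`. -/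
def vectorVariance (F : E → B) (ν : Measure E) : ℝ :=
  ∫ x, ‖F x - ∫ y, F y ∂ν‖ ^ 2 ∂ν

/-- `β` is the I-projection of `α` on `C`: it belongs to `C`, has finite relative entropy with
respect to `α`, and is the unique minimizer of the relative entropy on `C`. -/
def IsIProjection (α : Measure E) (C : Set (Measure E)) (β : Measure E) : Prop :=
  β ∈ C ∧ InformationTheory.klDiv β α < ⊤ ∧
    (∀ ν ∈ C, InformationTheory.klDiv β α ≤ InformationTheory.klDiv ν α) ∧
    ∀ ν ∈ C, InformationTheory.klDiv ν α = InformationTheory.klDiv β α → ν = β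

end Constraint

section Conditioning

variable {E : Type u} [MeasurableSpace E]

/-- The empirical measure `L_n = (1/n) ∑_{i<n} δ_{x_i}` of a sequence, for `n ≥ 1`. -/
def empiricalMeasure (n : ℕ) (x : ℕ → E) : Measure E :=
  (n : ℝ≥0∞)⁻¹ • ∑ i ∈ Finset.range n, Measure.dirac (x i)

/-- The event `{L_n ∈ A}`. -/
def empiricalEvent {Ω : Type*} (X : ℕ → Ω → E) (n : ℕ) (A : Set (Measure E)) : Set Ω :=
  {ω | empiricalMeasure n (fun i => X i ω) ∈ A}

/-- The conditional law of the first `k` variables, given `L_n ∈ A`. -/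
def conditionalLaw {Ω : Type*} [MeasurableSpace Ω] (P : Measure Ω) (X : ℕ → Ω → E)
    (n k : ℕ) (A : Set (Measure E)) : Measure (Fin k → E) :=
  (ProbabilityTheory.cond P (empiricalEvent X n A)).map (fun ω (i : Fin k) => X i ω)

end Conditioning

/-- The total variation distance `sup_S |μ(S) - ν(S)|` (`S` measurable) of finite measures. -/
def totalVariationDist {S : Type*} [MeasurableSpace S] (μ ν : Measure S) : ℝ :=
  ⨆ A : {A : Set S // MeasurableSet A}, |μ.real A.1 - ν.real A.1|

end

/-!
Write `β = α*` for the tilted law and `m = ∫ F dβ`.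

*I-projection.* Since the domain of `Λ_F` is open, exponential moments of `‖F‖` survive the tilting
(`exists_integrable_exp_norm_tilted`), and `Λ_F` has the directional derivative `⟨μ, m⟩` at
`lamStar`. Moving from `lamStar` along a functional that separates a point from `K` shows `m ∈ K`,
and moving towards the origin shows that `m` minimizes `⟨lamStar, ·⟩` over `K`
(`tilted_mean_optimality`). The log-density of `β` with respect to `α` is `⟨lamStar, F⟩ - Λ_F`, so
the second property is the Pythagorean inequality `H(ν|α) ≥ H(ν|β) + H(β|α)` on `C(K)`
(`isIProjection_tilted`).

*Conditional laws.* The law `α^n` has density `Z^n exp (-⟨lamStar, ∑ F⟩)` with respect to `β^n`. By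
optimality of `m` this is at most `D exp (n ε_n ‖lamStar‖)` on the conditioning event, and it is at
least `D exp (-n ε_n ‖lamStar‖)` on the smaller event that the mean of `F` over the sample is within
`ε_n` of `m`. The conditioned law of the sample therefore has a density with respect to `β^n` of at
most `exp (2 n ε_n ‖lamStar‖)` divided by the `β^n`-probability of that smaller event
(`cond_sampleMean_le`).

That probability is not exponentially small (`eventually_exp_le_prob_norm_sum_le`). Type 2 gives
`E ‖S_n‖² ≤ c² n` for the centered sums, but as `ε_n √n` may be arbitrarily close to `c`,
Chebyshev's inequality is of no use. Instead, pushing the first `O(√n)` summands in a fixed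
direction shows that `‖S_n‖ ≥ 2 c √n` has probability at least `exp (-O(√n))`. This excess of
`‖S_n‖²` over `c² n` has to be compensated, because the mean is at most `c² n`, and so
`‖S_n‖ ≤ c √n` is at least three times as likely.

Finally, a permutation invariant law on `E^n` with a density of size `exp (o(n))` with respect to
`β^n` has `k`-dimensional marginals close to `β^k`. By invariance the expectation of the centered
indicator of an event equals that of its average over `⌊n / k⌋` disjoint blocks, whose exponential
moments under `β^n` are controlled by Hoeffding's lemma (`real_marginal_sub_le`).
-/

/-! ### Duality and the I-projection -/

section Projection

variable {E : Type u} [MeasurableSpace E] {B : Type v} [NormedAddCommGroup B] [NormedSpace ℝ B]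
  {α : Measure E} {F : E → B} {K : Set B}

lemma logLaplace_eq_log_integral {lam : StrongDual ℝ B}
    (h : Integrable (fun x => Real.exp (lam (F x))) α) :
    logLaplace α F lam = ENNReal.log (ENNReal.ofReal (∫ x, Real.exp (lam (F x)) ∂α)) := by
  rw [logLaplace, laplaceTransform, ofReal_integral_eq_lintegral_ofReal h
    (Eventually.of_forall fun x => (Real.exp_pos _).le)]

lemma logLaplace_eq_coe [IsProbabilityMeasure α] {lam : StrongDual ℝ B}
    (h : Integrable (fun x => Real.exp (lam (F x))) α) :
    logLaplace α F lam = ((Real.log (∫ x, Real.exp (lam (F x)) ∂α) : ℝ) : EReal) := by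
  rw [logLaplace_eq_log_integral h, ENNReal.log_ofReal_of_pos (integral_exp_pos h)]

/-- The Pythagorean inequality of relative entropies gives the I-projection. -/
lemma isIProjection_tilted [CompleteSpace B] [IsProbabilityMeasure α] {lamStar : StrongDual ℝ B}
    (hint : Integrable (fun x => Real.exp (lamStar (F x))) α)
    (hFint : Integrable F (α.tilted fun x => lamStar (F x)))
    (hmem : ∫ x, F x ∂(α.tilted fun x => lamStar (F x)) ∈ K)
    (hle : ∀ y ∈ K, lamStar (∫ x, F x ∂(α.tilted fun x => lamStar (F x))) ≤ lamStar y) :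
    IsIProjection α (momentConstraint F K) (α.tilted fun x => lamStar (F x)) := by
  have hβp : IsProbabilityMeasure (α.tilted fun x => lamStar (F x)) :=
    isProbabilityMeasure_tilted hint
  set β := α.tilted fun x => lamStar (F x) with hβ
  have hβα : β ≪ α := tilted_absolutelyContinuous _ _
  have hllr : llr β α =ᵐ[β] fun x => lamStar (F x) -
      Real.log (∫ x, Real.exp (lamStar (F x)) ∂α) :=
    hβα.ae_le (log_rnDeriv_tilted_left_self hint)
  have hlint : Integrable (fun x => lamStar (F x)) β := lamStar.integrable_comp hFint
  have hllr_int : Integrable (llr β α) β :=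
    (integrable_congr hllr).2 (hlint.sub (integrable_const _))
  have hβtop : InformationTheory.klDiv β α ≠ ⊤ := InformationTheory.klDiv_ne_top hβα hllr_int
  have hβval : (InformationTheory.klDiv β α).toReal = lamStar (∫ x, F x ∂β) -
      Real.log (∫ x, Real.exp (lamStar (F x)) ∂α) := by
    rw [InformationTheory.toReal_klDiv_of_measure_eq hβα (by simp), integral_congr_ae hllr,
      integral_sub hlint (integrable_const _), lamStar.integral_comp_comm hFint]
    simp
  -- the Pythagorean inequality
  have hpyth : ∀ ν ∈ momentConstraint F K, InformationTheory.klDiv ν α ≠ ⊤ →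
      InformationTheory.klDiv ν β ≠ ⊤ ∧ (InformationTheory.klDiv ν β).toReal +
        (InformationTheory.klDiv β α).toReal ≤ (InformationTheory.klDiv ν α).toReal := by
    rintro ν ⟨hνp, hνF, hνK⟩ hν
    obtain ⟨hνα, hνint⟩ := InformationTheory.klDiv_ne_top_iff.1 hν
    have hνβ : ν ≪ β := hνα.trans (absolutelyContinuous_tilted hint)
    have hlν : Integrable (fun x => lamStar (F x)) ν := lamStar.integrable_comp hνF
    refine ⟨InformationTheory.klDiv_ne_top hνβ
      (integrable_llr_tilted_right hνα hlν hνint hint), ?_⟩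
    rw [hβval, InformationTheory.toReal_klDiv_of_measure_eq hνα (by simp),
      InformationTheory.toReal_klDiv_of_measure_eq hνβ (by simp),
      integral_llr_tilted_right hνα hlν hint hνint, lamStar.integral_comp_comm hνF]
    have := hle _ hνK
    linarith
  refine ⟨⟨hβp, hFint, hmem⟩, hβtop.lt_top, fun ν hν => ?_, fun ν hν heq => ?_⟩
  · by_cases hνtop : InformationTheory.klDiv ν α = ⊤
    · simp [hνtop]
    · rw [← ENNReal.toReal_le_toReal hβtop hνtop]
      have := (hpyth ν hν hνtop).2
      have := ENNReal.toReal_nonneg (a := InformationTheory.klDiv ν β)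
      linarith
  · have hνp := hν.1
    obtain ⟨h1, h2⟩ := hpyth ν hν (heq ▸ hβtop)
    rw [heq] at h2
    have h3 : (InformationTheory.klDiv ν β).toReal = 0 :=
      le_antisymm (by linarith) ENNReal.toReal_nonneg
    rw [ENNReal.toReal_eq_zero_iff, or_iff_left h1] at h3
    exact InformationTheory.klDiv_eq_zero_iff.1 h3

variable [MeasurableSpace B] [BorelSpace B]

lemma measurable_dual_comp (hF : Measurable F) (lam : StrongDual ℝ B) :
    Measurable fun x => lam (F x) :=
  lam.continuous.measurable.comp hF

lemma mem_domLogLaplace_iff (hF : Measurable F) (lam : StrongDual ℝ B) :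
    lam ∈ domLogLaplace α F ↔ Integrable (fun x => Real.exp (lam (F x))) α := by
  have hm : AEStronglyMeasurable (fun x => Real.exp (lam (F x))) α :=
    (measurable_dual_comp hF lam).exp.aestronglyMeasurable
  rw [domLogLaplace, Set.mem_ofPred_eq, logLaplace, ENNReal.log_lt_top_iff, laplaceTransform,
    Integrable, and_iff_right hm, hasFiniteIntegral_iff_ofReal
      (Eventually.of_forall fun x => (Real.exp_pos _).le)]

/-- What the minimality of `lamStar` says in real numbers. Comparison with `lam = 0` shows that
`Λ_F(lamStar)` and `s = inf_K ⟨lamStar, ·⟩` are finite. -/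
lemma dualFunctional_minimizer [IsProbabilityMeasure α] (hF : Measurable F) (hK : K.Nonempty)
    {lamStar : StrongDual ℝ B}
    (hmin : ∀ lam, dualFunctional α F K lamStar ≤ dualFunctional α F K lam) :
    Integrable (fun x => Real.exp (lamStar (F x))) α ∧
      ∃ s : ℝ, IsGLB (lamStar '' K) s ∧ ∀ lam : StrongDual ℝ B,
        Integrable (fun x => Real.exp (lam (F x))) α → ∀ r : ℝ, (∀ y ∈ K, r ≤ lam y) →
          Real.log (∫ x, Real.exp (lamStar (F x)) ∂α) - s ≤
            Real.log (∫ x, Real.exp (lam (F x)) ∂α) - r := by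
  obtain ⟨y₀, hy₀⟩ := hK
  have h0 : dualFunctional α F K 0 ≤ 0 := by
    have : logLaplace α F (0 : StrongDual ℝ B) = 0 := by
      rw [logLaplace_eq_coe (by simp)]; simp
    rw [dualFunctional, this, zero_sub, EReal.neg_le_zero]
    simp
  have hlt : dualFunctional α F K lamStar < ⊤ := ((hmin 0).trans h0).trans_lt EReal.zero_lt_top
  have hinf_ne_top : (⨅ y ∈ K, ((lamStar y : ℝ) : EReal)) ≠ ⊤ :=
    ((iInf₂_le y₀ hy₀).trans_lt (EReal.coe_lt_top _)).ne
  have hdomS : logLaplace α F lamStar ≠ ⊤ := by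
    intro h
    rw [dualFunctional, h, EReal.top_sub hinf_ne_top] at hlt
    exact lt_irrefl _ hlt
  have hint := (mem_domLogLaplace_iff (α := α) hF lamStar).1 (lt_top_iff_ne_top.2 hdomS)
  have hinf_ne_bot : (⨅ y ∈ K, ((lamStar y : ℝ) : EReal)) ≠ ⊥ := by
    intro h
    rw [dualFunctional, h, logLaplace_eq_coe hint, EReal.coe_sub_bot] at hlt
    exact lt_irrefl _ hlt
  obtain ⟨s, hs⟩ : ∃ s : ℝ, (s : EReal) = ⨅ y ∈ K, ((lamStar y : ℝ) : EReal) :=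
    ⟨_, EReal.coe_toReal hinf_ne_top hinf_ne_bot⟩
  refine ⟨hint, s, ⟨?_, ?_⟩, fun lam hlam r hr => ?_⟩
  · rintro _ ⟨y, hy, rfl⟩
    have : (s : EReal) ≤ (lamStar y : ℝ) := hs ▸ iInf₂_le y hy
    exact_mod_cast this
  · intro b hb
    have : (b : EReal) ≤ s := by
      rw [hs]
      exact le_iInf₂ fun y hy => by exact_mod_cast hb ⟨y, hy, rfl⟩
    exact_mod_cast this
  · have h1 := hmin lam
    have h2 : (r : EReal) ≤ ⨅ y ∈ K, ((lam y : ℝ) : EReal) :=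
      le_iInf₂ fun y hy => by exact_mod_cast hr y hy
    have h3 : dualFunctional α F K lam ≤
        ((Real.log (∫ x, Real.exp (lam (F x)) ∂α) - r : ℝ) : EReal) := by
      rw [dualFunctional, logLaplace_eq_coe hlam, EReal.coe_sub]
      exact EReal.sub_le_sub le_rfl h2
    have h4 := h1.trans h3
    rw [dualFunctional, logLaplace_eq_coe hint, ← hs, ← EReal.coe_sub] at h4
    exact_mod_cast h4

/-- The derivative test behind both optimality conditions: if `Λ_F` grows at least at rate `r`
from `lamStar` in the direction `μ`, then its directional derivative `∫ ⟨μ, F⟩ dα*` there is at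
least `r`. -/
lemma le_integral_dual_tilted [IsProbabilityMeasure α] (hF : Measurable F)
    (hdom : IsOpen (domLogLaplace α F)) {lamStar : StrongDual ℝ B}
    (hint : Integrable (fun x => Real.exp (lamStar (F x))) α)
    (μ : StrongDual ℝ B) (r : ℝ)
    (h : ∀ t : ℝ, 0 < t → t ≤ 1 →
      Integrable (fun x => Real.exp ((lamStar + t • μ) (F x))) α →
        t * r ≤ Real.log (∫ x, Real.exp ((lamStar + t • μ) (F x)) ∂α) -
          Real.log (∫ x, Real.exp (lamStar (F x)) ∂α)) :
    r ≤ ∫ x, μ (F x) ∂(α.tilted fun x => lamStar (F x)) := by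
  set β := α.tilted fun x => lamStar (F x) with hβ
  have : IsProbabilityMeasure β := isProbabilityMeasure_tilted hint
  have hexp : ∀ t : ℝ, (fun x => Real.exp ((lamStar + t • μ) (F x))) =
      fun x => Real.exp (lamStar (F x)) • Real.exp (t * μ (F x)) := by
    intro t; ext x; simp [Real.exp_add]
  have hset : integrableExpSet (fun x => μ (F x)) β =
      (fun t : ℝ => lamStar + t • μ) ⁻¹' domLogLaplace α F := by
    ext t
    rw [Set.mem_preimage, mem_domLogLaplace_iff hF, hexp, ← integrable_tilted_iff hint]
    rfl
  have hopen : IsOpen ((fun t : ℝ => lamStar + t • μ) ⁻¹' domLogLaplace α F) :=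
    hdom.preimage (by fun_prop)
  have h0mem : (0 : ℝ) ∈ (fun t : ℝ => lamStar + t • μ) ⁻¹' domLogLaplace α F := by
    simpa using (mem_domLogLaplace_iff (α := α) hF lamStar).2 hint
  have h0 : (0 : ℝ) ∈ interior (integrableExpSet (fun x => μ (F x)) β) := by
    rwa [hset, hopen.interior_eq]
  have hderiv := hasDerivAt_mgf h0
  simp only [zero_mul, Real.exp_zero, mul_one] at hderiv
  have hslope := hderiv.hasDerivWithinAt (s := Set.Ioi 0)
  rw [hasDerivWithinAt_iff_tendsto_slope' (by simp)] at hslope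
  refine ge_of_tendsto hslope ?_
  have hev : ∀ᶠ t : ℝ in 𝓝[>] 0, lamStar + t • μ ∈ domLogLaplace α F :=
    mem_nhdsWithin_of_mem_nhds (hopen.mem_nhds h0mem)
  filter_upwards [hev, Ioc_mem_nhdsGT zero_lt_one] with t ht ht1
  have hti := (mem_domLogLaplace_iff hF _).1 ht
  have hge := h t ht1.1 ht1.2 hti
  have hmgf : mgf (fun x => μ (F x)) β t = (∫ x, Real.exp ((lamStar + t • μ) (F x)) ∂α) /
      ∫ x, Real.exp (lamStar (F x)) ∂α := by
    rw [mgf, hβ, integral_exp_tilted]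
    simp
  have hpos := integral_exp_pos hti
  have hpos0 := integral_exp_pos hint
  rw [← Real.log_div hpos.ne' hpos0.ne', ← hmgf] at hge
  have hmgfpos : 0 < mgf (fun x => μ (F x)) β t := by rw [hmgf]; positivity
  have := Real.log_le_sub_one_of_pos hmgfpos
  rw [slope_def_field, mgf_zero, sub_zero, le_div_iff₀ ht1.1]
  linarith

/-- Openness of the domain of `Λ_F` lets an exponential moment of `‖F‖` survive the tilting. -/
lemma exists_integrable_exp_norm_tilted (hF : Measurable F)
    (hFtau : MemLtau α (fun x => ‖F x‖)) (hdom : IsOpen (domLogLaplace α F))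
    {lamStar : StrongDual ℝ B} (hint : Integrable (fun x => Real.exp (lamStar (F x))) α) :
    ∃ κ : ℝ, 0 < κ ∧
      Integrable (fun x => Real.exp (κ * ‖F x‖)) (α.tilted fun x => lamStar (F x)) := by
  obtain ⟨-, s, hs, hslt⟩ := hFtau
  have hmn : Measurable fun x => ‖F x‖ := hF.norm
  have hsint : Integrable (fun x => Real.exp (s * ‖F x‖)) α := by
    refine ⟨(hmn.const_mul s).exp.aestronglyMeasurable, ?_⟩
    rw [hasFiniteIntegral_iff_ofReal (Eventually.of_forall fun x => (Real.exp_pos _).le)]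
    simpa using hslt
  have hopen : IsOpen ((fun t : ℝ => (1 + t) • lamStar) ⁻¹' domLogLaplace α F) :=
    hdom.preimage (by fun_prop)
  have h0mem : (0 : ℝ) ∈ (fun t : ℝ => (1 + t) • lamStar) ⁻¹' domLogLaplace α F := by
    simpa using (mem_domLogLaplace_iff (α := α) hF lamStar).2 hint
  have hev : ∀ᶠ t : ℝ in 𝓝[>] 0, (1 + t) • lamStar ∈ domLogLaplace α F :=
    mem_nhdsWithin_of_mem_nhds (hopen.mem_nhds h0mem)
  obtain ⟨δ, hδdom, hδ⟩ := (hev.and self_mem_nhdsWithin).exists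
  have hδ : 0 < δ := hδ
  have hδint := (mem_domLogLaplace_iff hF _).1 hδdom
  refine ⟨s * (δ / (1 + δ)), by positivity, (integrable_tilted_iff hint _).2 ?_⟩
  -- convexity of `exp` with weights `1 / (1 + δ)` and `δ / (1 + δ)`
  refine Integrable.mono' (hδint.add hsint) ?_ (Eventually.of_forall fun x => ?_)
  · exact ((measurable_dual_comp hF lamStar).exp.smul
      (hmn.const_mul _).exp).aestronglyMeasurable
  · have hw : 1 / (1 + δ) + δ / (1 + δ) = 1 := by field_simp
    have hc := convexOn_exp.2 (Set.mem_univ ((1 + δ) * lamStar (F x)))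
      (Set.mem_univ (s * ‖F x‖)) (by positivity : 0 ≤ 1 / (1 + δ))
      (by positivity : 0 ≤ δ / (1 + δ)) hw
    have hle1 : 1 / (1 + δ) ≤ 1 := by rw [div_le_one (by positivity)]; linarith
    have hle2 : δ / (1 + δ) ≤ 1 := by rw [div_le_one (by positivity)]; linarith
    rw [smul_eq_mul, ← Real.exp_add, Real.norm_of_nonneg (Real.exp_pos _).le]
    simp only [smul_eq_mul, Pi.add_apply, smul_apply] at hc ⊢
    calc _ = Real.exp (1 / (1 + δ) * ((1 + δ) * lamStar (F x)) +
          δ / (1 + δ) * (s * ‖F x‖)) := by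
          congr 1
          field_simp
      _ ≤ _ := hc
      _ ≤ _ := add_le_add (mul_le_of_le_one_left (Real.exp_pos _).le hle1)
          (mul_le_of_le_one_left (Real.exp_pos _).le hle2)

lemma memLp_two_tilted [IsProbabilityMeasure α] [SecondCountableTopology B] (hF : Measurable F)
    (hFtau : MemLtau α (fun x => ‖F x‖)) (hdom : IsOpen (domLogLaplace α F))
    {lamStar : StrongDual ℝ B} (hint : Integrable (fun x => Real.exp (lamStar (F x))) α) :
    MemLp F 2 (α.tilted fun x => lamStar (F x)) := by
  obtain ⟨κ, hκ, hκint⟩ := exists_integrable_exp_norm_tilted hF hFtau hdom hint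
  have : IsProbabilityMeasure (α.tilted fun x => lamStar (F x)) := isProbabilityMeasure_tilted hint
  rw [← memLp_norm_iff hF.aestronglyMeasurable, memLp_two_iff_integrable_sq
    hF.norm.aestronglyMeasurable]
  refine integrable_pow_of_integrable_exp_mul hκ.ne' hκint ?_ 2
  refine Integrable.mono' (integrable_const (1 : ℝ))
    (hF.norm.const_mul _).exp.aestronglyMeasurable (Eventually.of_forall fun x => ?_)
  rw [Real.norm_of_nonneg (Real.exp_pos _).le, Real.exp_le_one_iff]
  have := norm_nonneg (F x)
  nlinarith

/-- Optimality of `lamStar`: the tilted mean lies in `K`, and it minimizes `⟨lamStar, ·⟩`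
over `K`. -/
lemma tilted_mean_optimality [CompleteSpace B] [SecondCountableTopology B]
    [IsProbabilityMeasure α] (hF : Measurable F)
    (hFtau : MemLtau α (fun x => ‖F x‖)) (hdom : IsOpen (domLogLaplace α F))
    (hKne : K.Nonempty) (hKclosed : IsClosed K) (hKconv : Convex ℝ K)
    {lamStar : StrongDual ℝ B}
    (hmin : ∀ lam, dualFunctional α F K lamStar ≤ dualFunctional α F K lam) :
    ∫ x, F x ∂(α.tilted fun x => lamStar (F x)) ∈ K ∧
      ∀ y ∈ K, lamStar (∫ x, F x ∂(α.tilted fun x => lamStar (F x))) ≤ lamStar y := by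
  obtain ⟨hint, s, hs, hmin'⟩ := dualFunctional_minimizer hF hKne hmin
  have : IsProbabilityMeasure (α.tilted fun x => lamStar (F x)) := isProbabilityMeasure_tilted hint
  have hFint : Integrable F (α.tilted fun x => lamStar (F x)) :=
    (memLp_two_tilted hF hFtau hdom hint).integrable one_le_two
  constructor
  · by_contra hm
    obtain ⟨f, w, hfw, hw⟩ := geometric_hahn_banach_point_closed hKconv hKclosed hm
    refine hfw.not_ge ?_
    rw [← f.integral_comp_comm hFint]
    refine le_integral_dual_tilted hF hdom hint f w fun t ht _ htint => ?_
    have := hmin' _ htint (s + t * w) fun y hy => by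
      have h1 := hs.1 ⟨y, hy, rfl⟩
      have h2 := mul_le_mul_of_nonneg_left (hw y hy).le ht.le
      simpa using add_le_add h1 h2
    linarith
  · have : -s ≤ ∫ x, (-lamStar) (F x) ∂(α.tilted fun x => lamStar (F x)) := by
      refine le_integral_dual_tilted hF hdom hint (-lamStar) (-s) fun t ht ht1 htint => ?_
      have := hmin' _ htint ((1 - t) * s) fun y hy => by
        have h1 := mul_le_mul_of_nonneg_left (hs.1 ⟨y, hy, rfl⟩) (sub_nonneg.2 ht1)
        refine h1.trans_eq ?_
        simp
        ring
      linarith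
    rw [(-lamStar).integral_comp_comm hFint, neg_apply] at this
    intro y hy
    have h1 := hs.1 ⟨y, hy, rfl⟩
    linarith

end Projection

/-! ### Small balls for sums in spaces of type 2 -/

section SmallBall

lemma memLp_eval_infinitePi
    {B : Type*} [NormedAddCommGroup B] [MeasurableSpace B]
    {ρ : Measure B} [IsProbabilityMeasure ρ] (hρ : MemLp id 2 ρ) (i : ℕ) :
    MemLp (fun ω : ℕ → B => ω i) 2 (Measure.infinitePi fun _ : ℕ => ρ) :=
  hρ.comp_measurePreserving (measurePreserving_eval_infinitePi (fun _ : ℕ => ρ) i)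

/-- Some ball which avoids the origin is charged by every law other than the Dirac mass at `0`. -/
lemma exists_ball_measure_pos {B : Type*} [NormedAddCommGroup B] [MeasurableSpace B]
    [SecondCountableTopology B] {ρ : Measure B} (h : ¬ ∀ᵐ x ∂ρ, x = 0) :
    ∃ x : B, x ≠ 0 ∧ 0 < ρ (Metric.ball x (‖x‖ / 2)) := by
  by_contra! hcon
  refine h ?_
  filter_upwards [Measure.support_mem_ae (μ := ρ)] with x hx
  by_contra hx0
  have hpos := (Measure.mem_support_iff_forall x).1 hx _
    (Metric.ball_mem_nhds x (half_pos (norm_pos_iff.2 hx0)))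
  exact hpos.ne' (le_antisymm (hcon x hx0) zero_le)

lemma memLp_sum_infinitePi
    {B : Type*} [NormedAddCommGroup B] [MeasurableSpace B]
    {ρ : Measure B} [IsProbabilityMeasure ρ] (hρ : MemLp id 2 ρ)
    (s : Finset ℕ) :
    MemLp (fun ω : ℕ → B => ∑ i ∈ s, ω i) 2 (Measure.infinitePi fun _ : ℕ => ρ) :=
  memLp_finsetSum s fun i _ => memLp_eval_infinitePi hρ i

lemma integral_eval_infinitePi {B : Type*} [MeasurableSpace B]
    {G : Type*} [NormedAddCommGroup G] [NormedSpace ℝ G]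
    {ρ : Measure B} [IsProbabilityMeasure ρ] {f : B → G}
    (hf : AEStronglyMeasurable f ρ) (i : ℕ) :
    ∫ ω, f (ω i) ∂(Measure.infinitePi fun _ : ℕ => ρ) = ∫ x, f x ∂ρ := by
  have h := measurePreserving_eval_infinitePi (fun _ : ℕ => ρ) i
  conv_rhs => rw [← h.map_eq]
  rw [integral_map h.measurable.aemeasurable (by rwa [h.map_eq])]

lemma integral_sum_Ico_sq_eq {B : Type*} [NormedAddCommGroup B] [MeasurableSpace B] [BorelSpace B]
    [SecondCountableTopology B] (ρ : Measure B) [IsProbabilityMeasure ρ] (l n : ℕ) :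
    ∫ ω, ‖∑ i ∈ Finset.Ico l n, ω i‖ ^ 2 ∂(Measure.infinitePi fun _ : ℕ => ρ) =
      ∫ ω, ‖∑ i ∈ Finset.range (n - l), ω i‖ ^ 2 ∂(Measure.infinitePi fun _ : ℕ => ρ) := by
  have hshift := Measure.map_infinitePi_infinitePi_of_inj (P := fun _ : ℕ => ρ)
    (add_right_injective l)
  conv_rhs => rw [← hshift]
  rw [integral_map (by fun_prop : Measurable fun (ω : ℕ → B) (i : ℕ) => ω (l + i)).aemeasurable
    (by fun_prop : Measurable _).aestronglyMeasurable]
  simp_rw [Finset.sum_Ico_eq_sum_range]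

variable {B : Type v} [NormedAddCommGroup B] [NormedSpace ℝ B]
  [MeasurableSpace B] [BorelSpace B]

/-- The type 2 inequality for variables with an arbitrary variance; it is rescaled to variance one,
the degenerate case of variance zero being trivial. -/
lemma IsTypeTwoWith.integral_sum_sq_le {a : ℝ} (ha : IsTypeTwoWith B a) {ρ : Measure B}
    [IsProbabilityMeasure ρ] (hρ : MemLp id 2 ρ) (hmean : ∫ x, x ∂ρ = 0) (n : ℕ) :
    ∫ ω, ‖∑ i ∈ Finset.range n, ω i‖ ^ 2 ∂(Measure.infinitePi fun _ : ℕ => ρ) ≤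
      a * (∫ x, ‖x‖ ^ 2 ∂ρ) * n := by
  set Q := Measure.infinitePi fun _ : ℕ => ρ
  set v := ∫ x, ‖x‖ ^ 2 ∂ρ with hv
  have hv0 : 0 ≤ v := integral_nonneg fun x => by positivity
  have hsq : Integrable (fun x : B => ‖x‖ ^ 2) ρ := hρ.integrable_norm_pow two_ne_zero
  rcases hv0.eq_or_lt with hv0 | hvpos
  · have hzero : ∀ᵐ x ∂ρ, x = 0 := by
      filter_upwards [(integral_eq_zero_iff_of_nonneg (fun x => by positivity) hsq).1
        (hv.symm.trans hv0.symm)] with x hx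
      simpa using hx
    have hall : ∀ᵐ ω ∂Q, ∀ i : ℕ, ω i = 0 := ae_all_iff.2 fun i =>
      (measurePreserving_eval_infinitePi (fun _ : ℕ => ρ) i).quasiMeasurePreserving.ae hzero
    rw [← hv0, integral_congr_ae (g := fun _ => (0 : ℝ))]
    · simp
    · filter_upwards [hall] with ω hω
      simp [hω]
  · set σ := Real.sqrt v
    have hσ : 0 < σ := Real.sqrt_pos.2 hvpos
    have hσ2 : σ ^ 2 = v := Real.sq_sqrt hv0
    have h1 : ∀ i : ℕ, ∫ ω, ‖σ⁻¹ • ω i‖ ^ 2 ∂Q = 1 := by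
      intro i
      rw [integral_eval_infinitePi (f := fun x : B => ‖σ⁻¹ • x‖ ^ 2)
        (by fun_prop : Measurable _).aestronglyMeasurable]
      simp_rw [norm_smul, mul_pow]
      rw [integral_const_mul, ← hv, ← hσ2, Real.norm_of_nonneg (by positivity)]
      field_simp
    have key := ha.2 (ℕ → B) Q (fun i ω => σ⁻¹ • ω i) (fun i => by fun_prop)
      (fun i => (memLp_eval_infinitePi hρ i).const_smul _)
      (iIndepFun_infinitePi (X := fun _ x => σ⁻¹ • x) fun _ => by fun_prop)
      (fun i => by
        have h : ∀ i : ℕ, Q.map (fun ω => σ⁻¹ • ω i) = ρ.map (fun x => σ⁻¹ • x) := fun i => by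
          rw [← (measurePreserving_eval_infinitePi (fun _ : ℕ => ρ) i).map_eq,
            Measure.map_map (by fun_prop) (by fun_prop)]
          rfl
        rw [h, h])
      (fun i => by
        rw [integral_smul, integral_eval_infinitePi (f := fun x : B => x)
          hρ.aestronglyMeasurable, hmean, smul_zero])
      h1 n
    simp_rw [← Finset.smul_sum, norm_smul, mul_pow] at key
    rw [integral_const_mul, Real.norm_of_nonneg (by positivity)] at key
    have h2 : ∑ i ∈ Finset.range n, ∫ ω, ‖σ⁻¹‖ ^ 2 * ‖ω i‖ ^ 2 ∂Q = n := by
      simp_rw [norm_smul, mul_pow] at h1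
      rw [Finset.sum_congr rfl fun i _ => h1 i]
      simp
    rw [Real.norm_of_nonneg (by positivity)] at h2
    rw [h2, inv_pow, inv_mul_le_iff₀ (by positivity), hσ2] at key
    linarith

/-- If `‖S_n‖²` is at least `4 c² n` with some probability while its mean is at most `c² n`, then
it is at most `c² n` with at least three times that probability. -/
lemma three_mul_prob_le_of_integral_sq_le {Ω : Type*} [MeasurableSpace Ω] {Q : Measure Ω}
    [IsProbabilityMeasure Q] {S : Ω → ℝ} (hS : Measurable S) {b : ℝ} (hb : 0 < b)
    (hS2 : Integrable (fun ω => S ω ^ 2) Q) (hle : ∫ ω, S ω ^ 2 ∂Q ≤ b ^ 2) :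
    3 * Q.real {ω | 2 * b ≤ S ω} ≤ Q.real {ω | S ω ≤ b} := by
  have hU : MeasurableSet {ω | 2 * b ≤ S ω} := measurableSet_le measurable_const hS
  have hV : MeasurableSet {ω | S ω ≤ b} := measurableSet_le hS measurable_const
  have hpt : ∀ ω, b ^ 2 + ({ω | 2 * b ≤ S ω}.indicator (fun _ => 3 * b ^ 2) ω -
      {ω | S ω ≤ b}.indicator (fun _ => b ^ 2) ω) ≤ S ω ^ 2 := by
    intro ω
    by_cases h1 : 2 * b ≤ S ω
    · have h2 : ¬ S ω ≤ b := by linarith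
      simp only [Set.indicator, Set.mem_ofPred_eq, h1, h2, if_true, if_false]
      nlinarith
    · by_cases h2 : S ω ≤ b
      · simp only [Set.indicator, Set.mem_ofPred_eq, h1, h2, if_true, if_false]
        nlinarith
      · simp only [Set.indicator, Set.mem_ofPred_eq, h1, h2, if_false]
        nlinarith
  have i1 : Integrable ({ω | 2 * b ≤ S ω}.indicator (fun _ => 3 * b ^ 2)) Q :=
    (integrable_const _).indicator hU
  have i2 : Integrable ({ω | S ω ≤ b}.indicator (fun _ => b ^ 2)) Q :=
    (integrable_const _).indicator hV
  have := (integral_mono ((integrable_const (b ^ 2)).add (i1.sub i2)) hS2 hpt).trans hle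
  have heq : ∫ ω, (b ^ 2 + ({ω | 2 * b ≤ S ω}.indicator (fun _ => 3 * b ^ 2) ω -
      {ω | S ω ≤ b}.indicator (fun _ => b ^ 2) ω)) ∂Q =
      b ^ 2 + (Q.real {ω | 2 * b ≤ S ω} * (3 * b ^ 2) - Q.real {ω | S ω ≤ b} * b ^ 2) := by
    have i3 : Integrable (fun ω => {ω | 2 * b ≤ S ω}.indicator (fun _ => 3 * b ^ 2) ω -
        {ω | S ω ≤ b}.indicator (fun _ => b ^ 2) ω) Q := i1.sub i2
    rw [integral_add (integrable_const _) i3, integral_sub i1 i2,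
      integral_indicator_const _ hU, integral_indicator_const _ hV]
    simp
  have h3 := heq.symm.trans_le this
  have h4 : 3 * Q.real {ω | 2 * b ≤ S ω} * b ^ 2 ≤ Q.real {ω | S ω ≤ b} * b ^ 2 := by linarith
  exact le_of_mul_le_mul_right h4 (by positivity)

variable [SecondCountableTopology B]

/-- Forcing the first `l` summands into the ball around `x` pushes `‖S_n‖` above `2 b`; the
remaining summands do not undo this, by Chebyshev's inequality. -/
lemma pow_mul_le_prob_large_sum {ρ : Measure B} [IsProbabilityMeasure ρ] (hρ : MemLp id 2 ρ)
    {x : B} {b : ℝ} (hb : 0 < b) {l n : ℕ} (hln : l ≤ n)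
    (htail : ∫ ω, ‖∑ i ∈ Finset.range (n - l), ω i‖ ^ 2 ∂(Measure.infinitePi fun _ : ℕ => ρ) ≤
      b ^ 2)
    (hl : 4 * b ≤ l * (‖x‖ / 2)) :
    ρ.real (Metric.ball x (‖x‖ / 2)) ^ l * (3 / 4) ≤
      (Measure.infinitePi fun _ : ℕ => ρ).real
        {ω | 2 * b ≤ ‖∑ i ∈ Finset.range n, ω i‖} := by
  set Q := Measure.infinitePi fun _ : ℕ => ρ
  set U := Metric.ball x (‖x‖ / 2)
  have hUm : MeasurableSet U := Metric.isOpen_ball.measurableSet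
  set A : Set (ℕ → B) := {ω | ∀ i ∈ Finset.range l, ω i ∈ U}
  set D : Set (ℕ → B) := {ω | ‖∑ i ∈ Finset.Ico l n, ω i‖ ≤ 2 * b}
  have hA : Q.real A = ρ.real U ^ l := by
    have : A = Set.pi (Finset.range l) fun _ => U := rfl
    rw [measureReal_def, this, Measure.infinitePi_pi _ fun _ _ => hUm]
    simp [measureReal_def]
  have hDm : MeasurableSet D := measurableSet_le (by fun_prop) measurable_const
  have hAm : MeasurableSet A := by
    have : A = ⋂ i ∈ Finset.range l, (fun ω : ℕ → B => ω i) ⁻¹' U := by ext; simp [A]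
    rw [this]
    exact Finset.measurableSet_biInter _ fun i _ => hUm.preimage (by fun_prop)
  have hsqint : Integrable (fun ω : ℕ → B => ‖∑ i ∈ Finset.Ico l n, ω i‖ ^ 2) Q :=
    (memLp_sum_infinitePi hρ _).integrable_norm_pow two_ne_zero
  have hD : 3 / 4 ≤ Q.real D := by
    have hmk := mul_meas_ge_le_integral_of_nonneg (μ := Q)
      (f := fun ω : ℕ → B => ‖∑ i ∈ Finset.Ico l n, ω i‖ ^ 2)
      (Eventually.of_forall fun ω => by positivity) hsqint ((2 * b) ^ 2)
    rw [integral_sum_Ico_sq_eq ρ l n] at hmk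
    have hsub : Q.real Dᶜ ≤
        Q.real {ω | (2 * b) ^ 2 ≤ ‖∑ i ∈ Finset.Ico l n, ω i‖ ^ 2} := by
      refine measureReal_mono fun ω hω => ?_
      have hω : ¬ ‖∑ i ∈ Finset.Ico l n, ω i‖ ≤ 2 * b := hω
      exact pow_le_pow_left₀ (by positivity) (not_le.1 hω).le 2
    rw [probReal_compl_eq_one_sub hDm] at hsub
    have hb2 : 0 < b ^ 2 := by positivity
    nlinarith
  have hindep : IndepFun (fun (ω : ℕ → B) (i : Finset.range l) => ω i)
      (fun (ω : ℕ → B) (i : Finset.Ico l n) => ω i) Q := by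
    refine iIndepFun.indepFun_finset (f := fun (i : ℕ) (ω : ℕ → B) => ω i) _ _ ?_
      (iIndepFun_infinitePi (X := fun _ x => x) fun _ => measurable_id) fun i => by fun_prop
    rw [Finset.disjoint_left]
    intro i hi hi'
    rw [Finset.mem_range] at hi
    rw [Finset.mem_Ico] at hi'
    omega
  have hAD : Q.real (A ∩ D) = Q.real A * Q.real D := by
    have := hindep.measure_inter_preimage_eq_mul (s := {y | ∀ i, y i ∈ U})
      (t := {y | ‖∑ i, y i‖ ≤ 2 * b}) ?_ ?_
    · have e1 : (fun (ω : ℕ → B) (i : Finset.range l) => ω i) ⁻¹' {y | ∀ i, y i ∈ U} = A := by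
        ext ω
        simp [A]
      have e2 : (fun (ω : ℕ → B) (i : Finset.Ico l n) => ω i) ⁻¹' {y | ‖∑ i, y i‖ ≤ 2 * b} =
          D := by
        ext ω
        simp only [Set.mem_preimage, Set.mem_ofPred_eq, D]
        rw [Finset.sum_coe_sort (Finset.Ico l n) fun i => ω i]
      rw [e1, e2] at this
      simp [measureReal_def, this]
    · have : {y : Finset.range l → B | ∀ i, y i ∈ U} = Set.pi Set.univ fun _ => U := by
        ext; simp
      rw [this]
      exact MeasurableSet.univ_pi fun _ => hUm
    · exact measurableSet_le (by fun_prop) measurable_const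
  have hsub : A ∩ D ⊆ {ω | 2 * b ≤ ‖∑ i ∈ Finset.range n, ω i‖} := by
    rintro ω ⟨hωA, hωD⟩
    have hωD : ‖∑ i ∈ Finset.Ico l n, ω i‖ ≤ 2 * b := hωD
    have h1 : ‖(l : ℝ) • x - ∑ i ∈ Finset.range l, ω i‖ ≤ l * (‖x‖ / 2) := by
      have : (l : ℝ) • x - ∑ i ∈ Finset.range l, ω i = ∑ i ∈ Finset.range l, (x - ω i) := by
        simp [Finset.sum_sub_distrib, Nat.cast_smul_eq_nsmul]
      rw [this]
      refine (norm_sum_le_of_le _ (n := fun _ => ‖x‖ / 2) fun i hi => ?_).trans_eq (by simp)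
      have := hωA i hi
      rw [Metric.mem_ball', dist_eq_norm] at this
      exact this.le
    have h2 : ‖(l : ℝ) • x‖ = l * ‖x‖ := by simp [norm_smul]
    have h3 := norm_le_norm_add_norm_sub' ((l : ℝ) • x) (∑ i ∈ Finset.range l, ω i)
    have h4 := norm_le_norm_add_norm_sub' (∑ i ∈ Finset.range l, ω i)
      (∑ i ∈ Finset.range n, ω i)
    rw [← Finset.sum_range_add_sum_Ico _ hln, sub_add_cancel_left, norm_neg,
      Finset.sum_range_add_sum_Ico _ hln] at h4
    show 2 * b ≤ _
    linarith
  calc ρ.real U ^ l * (3 / 4) ≤ Q.real A * Q.real D := by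
        rw [hA]
        exact mul_le_mul_of_nonneg_left hD (by positivity)
    _ = Q.real (A ∩ D) := hAD.symm
    _ ≤ _ := measureReal_mono hsub

/-- The exponents that force `‖S_n‖` to be of order `√n` are negligible with respect to `n`. -/
lemma eventually_natCeil_mul_sqrt_le (C : ℝ) (hC : 0 ≤ C) {δ : ℝ} (hδ : 0 < δ) :
    ∀ᶠ n : ℕ in atTop, (⌈C * Real.sqrt n⌉₊ : ℝ) ≤ δ * n := by
  have ht : Tendsto (fun n : ℕ => Real.sqrt n) atTop atTop :=
    Real.tendsto_sqrt_atTop.comp tendsto_natCast_atTop_atTop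
  filter_upwards [ht.eventually_ge_atTop 1, ht.eventually_ge_atTop ((C + 1) / δ)] with n h1 h2
  have h3 := (Nat.ceil_lt_add_one (by positivity : 0 ≤ C * Real.sqrt n)).le
  rw [div_le_iff₀ hδ] at h2
  have h4 : Real.sqrt n * Real.sqrt n = n := Real.mul_self_sqrt (Nat.cast_nonneg n)
  nlinarith

/-- In a space of type 2, the centered sums `S_n` satisfy `‖S_n‖ ≤ √(a Var) √n` with a probability
that is not exponentially small. Chebyshev's inequality alone gives no lower bound at this
threshold. -/
theorem eventually_exp_le_prob_norm_sum_le {a : ℝ} (ha : IsTypeTwoWith B a) {ρ : Measure B}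
    [IsProbabilityMeasure ρ] (hρ : MemLp id 2 ρ) (hmean : ∫ x, x ∂ρ = 0) {δ : ℝ} (hδ : 0 < δ) :
    ∀ᶠ n : ℕ in atTop, Real.exp (-(δ * n)) ≤
      (Measure.infinitePi fun _ : ℕ => ρ).real
        {ω | ‖∑ i ∈ Finset.range n, ω i‖ ≤
          Real.sqrt (a * ∫ x, ‖x‖ ^ 2 ∂ρ) * Real.sqrt n} := by
  set Q := Measure.infinitePi fun _ : ℕ => ρ
  set v := ∫ x, ‖x‖ ^ 2 ∂ρ with hv
  have hv0 : 0 ≤ v := integral_nonneg fun x => by positivity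
  have hsq : Integrable (fun x : B => ‖x‖ ^ 2) ρ := hρ.integrable_norm_pow two_ne_zero
  by_cases hzero : ∀ᵐ x ∂ρ, x = 0
  · refine Eventually.of_forall fun n => ?_
    have hall : ∀ᵐ ω ∂Q, ∀ i : ℕ, ω i = 0 := ae_all_iff.2 fun i =>
      (measurePreserving_eval_infinitePi (fun _ : ℕ => ρ) i).quasiMeasurePreserving.ae hzero
    have h1 : Q.real {ω | ‖∑ i ∈ Finset.range n, ω i‖ ≤ Real.sqrt (a * v) * Real.sqrt n} = 1 := by
      rw [← probReal_univ (μ := Q)]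
      refine measureReal_congr (eventuallyEq_univ.2 ?_)
      filter_upwards [hall] with ω hω
      simp only [hω, Finset.sum_const_zero, norm_zero]
      positivity
    rw [h1, Real.exp_le_one_iff]
    have : 0 ≤ δ * n := by positivity
    linarith
  · have hvpos : 0 < v := by
      refine hv0.lt_of_ne fun h => hzero ?_
      filter_upwards [(integral_eq_zero_iff_of_nonneg (fun x => by positivity) hsq).1
        (hv.symm.trans h.symm)] with x hx
      simpa using hx
    obtain ⟨x, hx0, hx⟩ := exists_ball_measure_pos hzero
    set p := ρ.real (Metric.ball x (‖x‖ / 2))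
    have hp : 0 < p := ENNReal.toReal_pos hx.ne' (measure_ne_top _ _)
    have hp1 : p ≤ 1 := measureReal_le_one
    have hlogp : Real.log p ≤ 0 := Real.log_nonpos hp.le hp1
    set c := Real.sqrt (a * v)
    have hav : 0 < a * v := mul_pos ha.1 hvpos
    have hc : 0 < c := Real.sqrt_pos.2 hav
    have hr : 0 < ‖x‖ / 2 := half_pos (norm_pos_iff.2 hx0)
    have hC : 0 ≤ 4 * c / (‖x‖ / 2) := by positivity
    filter_upwards [eventually_natCeil_mul_sqrt_le _ hC one_pos,
      eventually_natCeil_mul_sqrt_le _ hC (div_pos hδ (by linarith : 0 < 1 - Real.log p)),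
      eventually_ge_atTop 1] with n hn1 hn2 hn
    have hnpos : (0 : ℝ) < n := by exact_mod_cast hn
    have hsn : 0 < Real.sqrt n := Real.sqrt_pos.2 hnpos
    set l := ⌈4 * c / (‖x‖ / 2) * Real.sqrt n⌉₊
    have hln : l ≤ n := by
      rw [one_mul] at hn1
      exact_mod_cast hn1
    have hb : 0 < c * Real.sqrt n := by positivity
    have hb2 : (c * Real.sqrt n) ^ 2 = a * v * n := by
      rw [mul_pow, Real.sq_sqrt hav.le, Real.sq_sqrt hnpos.le]
    have hl : 4 * (c * Real.sqrt n) ≤ l * (‖x‖ / 2) := by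
      have := Nat.le_ceil (4 * c / (‖x‖ / 2) * Real.sqrt n)
      have := mul_le_mul_of_nonneg_right this hr.le
      refine le_trans (le_of_eq ?_) this
      field_simp
    have htail : ∫ ω, ‖∑ i ∈ Finset.range (n - l), ω i‖ ^ 2 ∂Q ≤ (c * Real.sqrt n) ^ 2 := by
      refine (ha.integral_sum_sq_le hρ hmean _).trans ?_
      rw [hb2]
      exact mul_le_mul_of_nonneg_left (by exact_mod_cast Nat.sub_le n l) hav.le
    have h1 := pow_mul_le_prob_large_sum hρ hb hln htail hl
    have h2 := three_mul_prob_le_of_integral_sq_le (Q := Q)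
      (S := fun ω : ℕ → B => ‖∑ i ∈ Finset.range n, ω i‖) (by fun_prop) hb
      ((memLp_sum_infinitePi hρ _).integrable_norm_pow two_ne_zero)
      ((ha.integral_sum_sq_le hρ hmean n).trans hb2.ge)
    have h3 : Real.exp (-(δ * n)) ≤ p ^ l := by
      rw [← Real.exp_log (pow_pos hp l), Real.log_pow, Real.exp_le_exp]
      rw [div_mul_eq_mul_div, le_div_iff₀ (by linarith)] at hn2
      have : (0 : ℝ) ≤ l := Nat.cast_nonneg l
      nlinarith
    have h4 : 0 ≤ p ^ l := by positivity
    linarith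

end SmallBall

/-! ### Marginals of permutation invariant laws -/

section Exchangeable

variable {E : Type u} [MeasurableSpace E]

/-- Partitioning the first `q * k` coordinates of a product measure into `q` blocks of length `k`
gives independent blocks. -/
lemma iIndepFun_blocks (β : Measure E) [IsProbabilityMeasure β] {ι : Type*} [Fintype ι] {q k : ℕ}
    {b : Fin q × Fin k → ι} (hb : Function.Injective b) :
    iIndepFun (fun (j : Fin q) (x : ι → E) (i : Fin k) => x (b (j, i)))
      (Measure.pi fun _ : ι => β) := by
  rw [← Measure.infinitePi_eq_pi, iIndepFun_iff_map_fun_eq_infinitePi_map fun j => by fun_prop]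
  have h1 : ∀ j : Fin q, (Measure.infinitePi fun _ : ι => β).map
      (fun x (i : Fin k) => x (b (j, i))) = Measure.infinitePi fun _ : Fin k => β := fun j =>
    Measure.map_infinitePi_infinitePi_of_inj (P := fun _ : ι => β)
      (f := fun i : Fin k => b (j, i)) fun i i' h => (Prod.mk.inj (hb h)).2
  simp_rw [h1]
  have h2 := Measure.map_infinitePi_infinitePi_of_inj (P := fun _ : ι => β) hb
  rw [← Measure.infinitePi_map_curry (fun (_ : Fin q) (_ : Fin k) => β), ← h2,
    Measure.map_map (by fun_prop) (by fun_prop)]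
  rfl

lemma map_pi_comp_injective (β : Measure E) [IsProbabilityMeasure β] {ι κ : Type*} [Fintype ι]
    [Fintype κ] {f : κ → ι} (hf : Function.Injective f) :
    (Measure.pi fun _ : ι => β).map (fun x i => x (f i)) = Measure.pi fun _ : κ => β := by
  rw [← Measure.infinitePi_eq_pi, ← Measure.infinitePi_eq_pi]
  exact Measure.map_infinitePi_infinitePi_of_inj (P := fun _ : ι => β) hf

/-- If a permutation invariant law `ν` on `E^n` has a density at most `M` with respect to the
product law `β^n`, then its `k`-dimensional marginals are close to `β^k`, provided `log M` is small
compared with the number `q` of disjoint blocks of length `k`. Jensen's inequality is applied under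
`ν` to the exponential of the sum over the blocks, and Hoeffding's lemma under `β^n`. -/
lemma real_marginal_sub_le {β : Measure E} [IsProbabilityMeasure β] {n k q : ℕ}
    {ν : Measure (Fin n → E)} [IsProbabilityMeasure ν]
    (hν : ∀ σ : Equiv.Perm (Fin n), ν.map (fun x i => x (σ i)) = ν)
    {M : ℝ} (hM : ν ≤ ENNReal.ofReal M • Measure.pi fun _ : Fin n => β)
    (hq : 0 < q) (hqk : q * k ≤ n) (hkn : k ≤ n) {A : Set (Fin k → E)} (hA : MeasurableSet A)
    {t : ℝ} (ht : 0 < t) :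
    (ν.map fun x (i : Fin k) => x (Fin.castLE hkn i)).real A -
      (Measure.pi fun _ : Fin k => β).real A ≤ Real.log M / (t * q) + t / 8 := by
  set p := (Measure.pi fun _ : Fin k => β).real A with hp
  set b : Fin q × Fin k → Fin n := fun ji => Fin.castLE hqk (finProdFinEquiv ji) with hbdef
  have hb : Function.Injective b :=
    (Fin.castLE_injective hqk).comp finProdFinEquiv.injective
  have hbj : ∀ j, Function.Injective fun i : Fin k => b (j, i) := fun j i i' h =>
    (Prod.mk.inj (hb h)).2
  set φ : (Fin k → E) → ℝ := A.indicator fun _ => 1 with hφ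
  have hφm : Measurable φ := measurable_const.indicator hA
  have hφ01 : ∀ y, φ y ∈ Set.Icc (0 : ℝ) 1 := fun y =>
    ⟨Set.indicator_nonneg (fun _ _ => zero_le_one) y,
      Set.indicator_le_self' (fun _ _ => zero_le_one) y |>.trans le_rfl⟩
  set Y : Fin q → (Fin n → E) → ℝ := fun j x => φ (fun i => x (b (j, i))) - p with hY
  have hYm : ∀ j, Measurable (Y j) := fun j => by fun_prop
  have hYb : ∀ j x, |Y j x| ≤ 1 := by
    intro j x
    have h1 := hφ01 fun i => x (b (j, i))
    have h2 : 0 ≤ p := measureReal_nonneg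
    have h3 : p ≤ 1 := measureReal_le_one
    rw [abs_le]
    constructor <;> simp only [hY] <;> linarith [h1.1, h1.2]
  -- the blocks under `β^n`
  have hmean : ∀ j, ∫ x, φ (fun i => x (b (j, i))) ∂(Measure.pi fun _ : Fin n => β) = p := by
    intro j
    have := integral_map (μ := Measure.pi fun _ : Fin n => β)
      (φ := fun x (i : Fin k) => x (b (j, i)))
      (by fun_prop : Measurable _).aemeasurable
      (f := φ) hφm.aestronglyMeasurable
    rw [← this, map_pi_comp_injective β (hbj j), hφ, integral_indicator_const _ hA]
    simp [hp]
  have hsub : ∀ j ∈ (Finset.univ : Finset (Fin q)),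
      HasSubgaussianMGF (Y j) ((‖(1 : ℝ) - 0‖₊ / 2) ^ 2) (Measure.pi fun _ : Fin n => β) := by
    intro j _
    have := hasSubgaussianMGF_of_mem_Icc (μ := Measure.pi fun _ : Fin n => β)
      (X := fun x => φ fun i => x (b (j, i))) (a := 0) (b := 1)
      (by fun_prop : Measurable _).aemeasurable (Eventually.of_forall fun x => hφ01 _)
    rwa [hmean j] at this
  have hindep : iIndepFun Y (Measure.pi fun _ : Fin n => β) :=
    (iIndepFun_blocks β hb).comp (fun _ y => φ y - p) fun _ => by fun_prop
  have hmgf := (HasSubgaussianMGF.sum_of_iIndepFun hindep hsub).mgf_le t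
  -- the blocks under `ν`
  have hblock : ∀ j, ∫ x, Y j x ∂ν =
      (ν.map fun x (i : Fin k) => x (Fin.castLE hkn i)).real A - p := by
    intro j
    obtain ⟨σ, hσ⟩ := Equiv.Perm.exists_extending_pair _ _ (Fin.castLE_injective hkn) (hbj j)
    have h1 : ν.map (fun x (i : Fin k) => x (b (j, i))) =
        ν.map fun x (i : Fin k) => x (Fin.castLE hkn i) := by
      conv_rhs => rw [← hν σ]
      rw [Measure.map_map (by fun_prop) (by fun_prop)]
      simp_rw [Function.comp_def, hσ]
    rw [integral_sub _ (integrable_const _)]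
    · have := integral_map (μ := ν) (φ := fun x (i : Fin k) => x (b (j, i)))
        (by fun_prop : Measurable _).aemeasurable (f := φ) hφm.aestronglyMeasurable
      rw [← this, h1, hφ, integral_indicator_const _ hA]
      simp
    · exact Integrable.of_mem_Icc 0 1 (by fun_prop : Measurable _).aemeasurable
        (Eventually.of_forall fun x => hφ01 _)
  set d := (ν.map fun x (i : Fin k) => x (Fin.castLE hkn i)).real A - p
  set S : (Fin n → E) → ℝ := fun x => ∑ j, Y j x with hS
  have hSm : Measurable S := by fun_prop
  have hYint : ∀ j, Integrable (Y j) ν := fun j =>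
    Integrable.of_bound (hYm j).aestronglyMeasurable 1 (Eventually.of_forall fun x => hYb j x)
  have hSint : ∫ x, t * S x ∂ν = t * (q * d) := by
    rw [integral_const_mul, integral_finsetSum _ fun j _ => hYint j,
      Finset.sum_congr rfl fun j _ => hblock j]
    simp
  have hSb : ∀ x, |S x| ≤ q := fun x =>
    (Finset.abs_sum_le_sum_abs _ _).trans
      ((Finset.sum_le_sum fun j _ => hYb j x).trans_eq (by simp))
  have hexpint : ∀ (Q : Measure (Fin n → E)) [IsProbabilityMeasure Q],
      Integrable (fun x => Real.exp (t * S x)) Q := fun Q _ => by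
    refine Integrable.of_bound (by fun_prop : Measurable _).aestronglyMeasurable
      (Real.exp (t * q)) (Eventually.of_forall fun x => ?_)
    rw [Real.norm_of_nonneg (Real.exp_pos _).le, Real.exp_le_exp]
    exact mul_le_mul_of_nonneg_left (le_of_abs_le (hSb x)) ht.le
  have hjensen : Real.exp (t * (q * d)) ≤ ∫ x, Real.exp (t * S x) ∂ν := by
    rw [← hSint]
    exact convexOn_exp.map_integral_le Real.continuous_exp.continuousOn isClosed_univ
      (Eventually.of_forall fun x => Set.mem_univ _)
      ((integrable_finsetSum _ fun j _ => hYint j).const_mul t) (hexpint ν)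
  have hMpos : 0 < M := by
    by_contra hcon
    have h0 := hM Set.univ
    rw [ENNReal.ofReal_of_nonpos (not_lt.1 hcon)] at h0
    simp at h0
  have hcmp : ∫ x, Real.exp (t * S x) ∂ν ≤
      M * ∫ x, Real.exp (t * S x) ∂(Measure.pi fun _ : Fin n => β) := by
    have := integral_mono_measure hM (Eventually.of_forall fun x => (Real.exp_pos (t * S x)).le)
      ((hexpint _).smul_measure ENNReal.ofReal_ne_top)
    rwa [integral_smul_measure, ENNReal.toReal_ofReal hMpos.le, smul_eq_mul] at this
  have hmgf' : ∫ x, Real.exp (t * S x) ∂(Measure.pi fun _ : Fin n => β) ≤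
      Real.exp (q * (t ^ 2 / 8)) := by
    refine hmgf.trans_eq ?_
    congr 1
    simp
    ring
  have hfin := hjensen.trans (hcmp.trans (mul_le_mul_of_nonneg_left hmgf' hMpos.le))
  rw [← Real.exp_log hMpos, ← Real.exp_add, Real.exp_le_exp] at hfin
  have hqpos : (0 : ℝ) < q := by exact_mod_cast hq
  rw [← sub_le_iff_le_add, le_div_iff₀ (by positivity)]
  nlinarith

end Exchangeable

/-! ### Change of measure and conditioning -/

section ChangeOfMeasure

lemma pi_withDensity {E : Type*} [MeasurableSpace E] (μ : Measure E) [IsProbabilityMeasure μ]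
    {w : E → ℝ≥0∞} (hw : Measurable w) [IsProbabilityMeasure (μ.withDensity w)]
    {ι : Type*} [Fintype ι] :
    Measure.pi (fun _ : ι => μ.withDensity w) =
      (Measure.pi fun _ : ι => μ).withDensity fun x => ∏ i, w (x i) := by
  refine Measure.pi_eq fun s hs => ?_
  have hind : ∀ i, Measurable ((s i).indicator w) := fun i => hw.indicator (hs i)
  have hpt : (Set.univ.pi s).indicator (fun x : ι → E => ∏ i, w (x i)) =
      fun x => ∏ i, (s i).indicator w (x i) := by
    ext x
    by_cases hx : x ∈ Set.univ.pi s
    · rw [Set.indicator_of_mem hx]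
      exact Finset.prod_congr rfl fun i _ => (Set.indicator_of_mem (hx i trivial) w).symm
    · rw [Set.indicator_of_notMem hx]
      obtain ⟨i, hi⟩ : ∃ i, x i ∉ s i := by simpa using hx
      exact (Finset.prod_eq_zero (Finset.mem_univ i) (Set.indicator_of_notMem hi w)).symm
  rw [withDensity_apply _ (MeasurableSet.univ_pi hs), ← lintegral_indicator
    (MeasurableSet.univ_pi hs), hpt, lintegral_prod_eq_prod_lintegral_of_indepFun Finset.univ
    (fun i (x : ι → E) => (s i).indicator w (x i))
    (iIndepFun_pi (μ := fun _ : ι => μ) fun i => (hind i).aemeasurable) fun i => by fun_prop]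
  refine Finset.prod_congr rfl fun i _ => ?_
  rw [(measurePreserving_eval (fun _ : ι => μ) i).lintegral_comp (hind i),
    lintegral_indicator (hs i), withDensity_apply _ (hs i)]

lemma map_cond_preimage {Ω S : Type*} [MeasurableSpace Ω] [MeasurableSpace S] {P : Measure Ω}
    {T : Ω → S} (hT : Measurable T) {A : Set S} (hA : MeasurableSet A) :
    (ProbabilityTheory.cond P (T ⁻¹' A)).map T = ProbabilityTheory.cond (P.map T) A := by
  ext D hD
  rw [Measure.map_apply hT hD, cond_apply (hT hA), cond_apply hA, Measure.map_apply hT hA,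
    Measure.map_apply hT (hA.inter hD), Set.preimage_inter]

/-- If a density is at most `u` on `A` and at least `l` on a subset `G` of `A`, then conditioning
on `A` gives a law with density at most `u / (l ν(G))`. -/
lemma cond_withDensity_le {S : Type*} [MeasurableSpace S] {ν : Measure S} [IsProbabilityMeasure ν]
    {W : S → ℝ≥0∞} {A G : Set S} (hA : MeasurableSet A) (hG : MeasurableSet G) (hGA : G ⊆ A)
    {u l : ℝ} (hl : 0 < l) (hWA : ∀ x ∈ A, W x ≤ ENNReal.ofReal u)
    (hWG : ∀ x ∈ G, ENNReal.ofReal l ≤ W x) (hνG : 0 < ν.real G) :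
    0 < ν.withDensity W A ∧
      ProbabilityTheory.cond (ν.withDensity W) A ≤ ENNReal.ofReal (u / (l * ν.real G)) • ν := by
  have hlow : ENNReal.ofReal (l * ν.real G) ≤ ν.withDensity W A := by
    refine le_trans ?_ (measure_mono hGA)
    rw [withDensity_apply _ hG, ENNReal.ofReal_mul hl.le, ofReal_measureReal, ← setLIntegral_const]
    exact setLIntegral_mono' hG hWG
  have hpos : 0 < l * ν.real G := by positivity
  refine ⟨(ENNReal.ofReal_pos.2 hpos).trans_le hlow, Measure.le_iff.2 fun D hD => ?_⟩
  have hup : ν.withDensity W (A ∩ D) ≤ ENNReal.ofReal u * ν D := by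
    rw [withDensity_apply _ (hA.inter hD)]
    calc _ ≤ ∫⁻ _ in A ∩ D, ENNReal.ofReal u ∂ν :=
          setLIntegral_mono' (hA.inter hD) fun x hx => hWA x hx.1
      _ = ENNReal.ofReal u * ν (A ∩ D) := setLIntegral_const _ _
      _ ≤ _ := by gcongr; exact Set.inter_subset_right
  rw [cond_apply hA, Measure.smul_apply, smul_eq_mul, ENNReal.ofReal_div_of_pos hpos,
    ENNReal.div_eq_inv_mul, mul_assoc]
  gcongr

end ChangeOfMeasure

/-! ### Conditioning on the sample mean -/

section Conditioning

variable {E : Type u} {B : Type v} [NormedAddCommGroup B] [NormedSpace ℝ B]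

/-- The arithmetic mean of `F` over a finite sample. -/
noncomputable def sampleMean (F : E → B) {n : ℕ} (x : Fin n → E) : B :=
  (n : ℝ)⁻¹ • ∑ i, F (x i)

lemma sampleMean_comp_perm (F : E → B) {n : ℕ} (σ : Equiv.Perm (Fin n)) (x : Fin n → E) :
    sampleMean F (fun i => x (σ i)) = sampleMean F x := by
  rw [sampleMean, sampleMean, Equiv.sum_comp σ fun i => F (x i)]

lemma sampleMean_sub_const (F : E → B) (m : B) {n : ℕ} (hn : 0 < n) (x : Fin n → E) :
    sampleMean F x - m = (n : ℝ)⁻¹ • ∑ i, (F (x i) - m) := by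
  have : (n : ℝ) ≠ 0 := by exact_mod_cast hn.ne'
  rw [Finset.sum_sub_distrib, smul_sub, sampleMean, Finset.sum_const, Finset.card_univ,
    Fintype.card_fin, ← Nat.cast_smul_eq_nsmul ℝ, smul_smul, inv_mul_cancel₀ this, one_smul]

variable [MeasurableSpace E]

lemma measurable_sampleMean [MeasurableSpace B] [BorelSpace B] [SecondCountableTopology B]
    {F : E → B} (hF : Measurable F) (n : ℕ) :
    Measurable fun x : Fin n → E => sampleMean F x := by
  unfold sampleMean
  fun_prop

lemma empiricalMeasure_mem_momentConstraint_iff [CompleteSpace B] {F : E → B}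
    (hF : StronglyMeasurable F) (C : Set B) {n : ℕ} (hn : 0 < n) (x : ℕ → E) :
    empiricalMeasure n x ∈ momentConstraint F C ↔ sampleMean F (fun i : Fin n => x i) ∈ C := by
  have hn0 : (n : ℝ≥0∞) ≠ 0 := by exact_mod_cast hn.ne'
  have hprob : IsProbabilityMeasure (empiricalMeasure n x) := by
    constructor
    simp [empiricalMeasure, ENNReal.inv_mul_cancel hn0]
  have hd : ∀ i ∈ Finset.range n, Integrable F (Measure.dirac (x i)) := fun i _ =>
    integrable_dirac' hF enorm_lt_top
  have hint : Integrable F (empiricalMeasure n x) :=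
    (integrable_finsetSum_measure.2 hd).smul_measure (ENNReal.inv_ne_top.2 hn0)
  have hval : ∫ y, F y ∂(empiricalMeasure n x) = sampleMean F (fun i : Fin n => x i) := by
    rw [empiricalMeasure, integral_smul_measure, integral_finsetSum_measure hd, sampleMean,
      ← Fin.sum_univ_eq_sum_range fun i => ∫ y, F y ∂(Measure.dirac (x i))]
    simp [integral_dirac' _ _ hF]
  rw [← hval]
  exact ⟨fun h => h.2.2, fun h => ⟨hprob, hint, h⟩⟩

/-- Conditioning on `L_n` may be carried out on the product space of the first `n` variables. -/
lemma conditionalLaw_eq [MeasurableSpace B] [BorelSpace B] [SecondCountableTopology B]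
    [CompleteSpace B] {α : Measure E} {F : E → B} (hF : Measurable F) {C : Set B}
    (hC : MeasurableSet C) {Ω : Type*} [MeasurableSpace Ω] {P : Measure Ω}
    [IsProbabilityMeasure P] {X : ℕ → Ω → E} (hX : ∀ i, Measurable (X i)) (hindep : iIndepFun X P)
    (hlaw : ∀ i, P.map (X i) = α) {n : ℕ} (hn : 0 < n) :
    P (empiricalEvent X n (momentConstraint F C)) =
        (Measure.pi fun _ : Fin n => α) {x | sampleMean F x ∈ C} ∧
      ∀ (k : ℕ) (hkn : k ≤ n), conditionalLaw P X n k (momentConstraint F C) =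
        (ProbabilityTheory.cond (Measure.pi fun _ : Fin n => α) {x | sampleMean F x ∈ C}).map
          fun x (i : Fin k) => x (Fin.castLE hkn i) := by
  set T : Ω → Fin n → E := fun ω i => X i ω
  have hT : Measurable T := by fun_prop
  have hA : MeasurableSet {x : Fin n → E | sampleMean F x ∈ C} := measurable_sampleMean hF n hC
  have hev : empiricalEvent X n (momentConstraint F C) =
      T ⁻¹' {x : Fin n → E | sampleMean F x ∈ C} := by
    ext ω
    exact empiricalMeasure_mem_momentConstraint_iff hF.stronglyMeasurable C hn _
  have hmap : P.map T = Measure.pi fun _ : Fin n => α := by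
    have := (iIndepFun_iff_map_fun_eq_pi_map fun i : Fin n => (hX i).aemeasurable).1
      (hindep.precomp Fin.val_injective)
    simpa [hlaw] using this
  refine ⟨by rw [hev, ← hmap, Measure.map_apply hT hA], fun k hkn => ?_⟩
  rw [← hmap, ← map_cond_preimage hT hA, ← hev, Measure.map_map (by fun_prop) hT]
  rfl

lemma sub_mul_norm_le_of_mem_cthickening {K : Set B} {lam : StrongDual ℝ B} {s ε : ℝ}
    (hs : ∀ y ∈ K, s ≤ lam y) {z : B} (hz : z ∈ Metric.cthickening ε K) (hε : 0 ≤ ε) :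
    s - ε * ‖lam‖ ≤ lam z := by
  refine le_of_forall_pos_le_add fun η hη => ?_
  have hη' : 0 < η / (‖lam‖ + 1) := by positivity
  obtain ⟨y, hy, hzy⟩ := Metric.mem_thickening_iff.1
    (Metric.cthickening_subset_thickening' (by positivity : 0 < ε + η / (‖lam‖ + 1))
      (by linarith) K hz)
  have h2 := (Real.le_norm_self _).trans (lam.le_opNorm (y - z))
  rw [map_sub, ← dist_eq_norm, dist_comm] at h2
  have h3 := mul_le_mul_of_nonneg_left hzy.le (norm_nonneg lam)
  have h4 : ‖lam‖ * (η / (‖lam‖ + 1)) ≤ η := by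
    rw [mul_div_assoc', div_le_iff₀ (by positivity)]
    nlinarith [norm_nonneg lam]
  have h5 := hs y hy
  nlinarith

/-- The law of the sample conditioned on its mean lying in the `ε`-thickening of `K` has a density
with respect to the product of tilted measures. The Gibbs factor `exp (-⟨lam, ∑ F⟩)` varies on the
conditioning event by at most `exp (2 n ε ‖lam‖)` above its values near the tilted mean. -/
lemma cond_sampleMean_le [MeasurableSpace B] [BorelSpace B] [SecondCountableTopology B]
    {α : Measure E} [IsProbabilityMeasure α] {F : E → B} (hF : Measurable F) {K : Set B}
    {lam : StrongDual ℝ B} (hint : Integrable (fun x => Real.exp (lam (F x))) α) {m : B}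
    (hm : m ∈ K) (hle : ∀ y ∈ K, lam m ≤ lam y) {ε : ℝ} (hε : 0 ≤ ε) {n : ℕ} (hn : 0 < n)
    (hpos : 0 < (Measure.pi fun _ : Fin n => α.tilted fun x => lam (F x)).real
      {x | ‖sampleMean F x - m‖ ≤ ε}) :
    0 < (Measure.pi fun _ : Fin n => α) {x | sampleMean F x ∈ Metric.cthickening ε K} ∧
      ProbabilityTheory.cond (Measure.pi fun _ : Fin n => α)
          {x | sampleMean F x ∈ Metric.cthickening ε K} ≤
        ENNReal.ofReal (Real.exp (2 * n * ε * ‖lam‖) /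
          (Measure.pi fun _ : Fin n => α.tilted fun x => lam (F x)).real
            {x | ‖sampleMean F x - m‖ ≤ ε}) •
          Measure.pi fun _ : Fin n => α.tilted fun x => lam (F x) := by
  set f : E → ℝ := fun x => lam (F x) with hf
  have hfm : Measurable f := measurable_dual_comp hF lam
  set β := α.tilted f with hβ
  have : IsProbabilityMeasure β := isProbabilityMeasure_tilted hint
  have hn0 : (n : ℝ) ≠ 0 := by exact_mod_cast hn.ne'
  have hnpos : (0 : ℝ) < n := by exact_mod_cast hn
  set c := ∫ x, Real.exp ((-f) x) ∂β
  have hαβ : β.withDensity (fun x => ENNReal.ofReal (Real.exp ((-f) x) / c)) = α :=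
    tilted_neg_same hint
  have hc : 0 < c := by
    refine integral_exp_pos ((integrable_tilted_iff hint _).2 ?_)
    simp [hf, ← Real.exp_add]
  set w : E → ℝ≥0∞ := fun x => ENNReal.ofReal (Real.exp ((-f) x) / c) with hw
  have hwm : Measurable w := by fun_prop
  have : IsProbabilityMeasure (β.withDensity w) := by rwa [hαβ]
  have hpi := pi_withDensity β hwm (ι := Fin n)
  rw [hαβ] at hpi
  have hW : ∀ x : Fin n → E, ∏ i, w (x i) =
      ENNReal.ofReal (Real.exp (-(n * lam (sampleMean F x))) / c ^ n) := by
    intro x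
    rw [hw, ← ENNReal.ofReal_prod_of_nonneg fun i _ => by positivity, Finset.prod_div_distrib,
      ← Real.exp_sum, sampleMean, map_smul, smul_eq_mul, mul_inv_cancel_left₀ hn0, map_sum]
    simp [hf]
  rw [hpi]
  have hsm := measurable_sampleMean hF n
  have key := cond_withDensity_le (ν := Measure.pi fun _ : Fin n => β)
    (W := fun x => ∏ i, w (x i))
    (A := {x | sampleMean F x ∈ Metric.cthickening ε K}) (G := {x | ‖sampleMean F x - m‖ ≤ ε})
    (u := Real.exp (-(n * (lam m - ε * ‖lam‖))) / c ^ n)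
    (l := Real.exp (-(n * (lam m + ε * ‖lam‖))) / c ^ n)
    (hsm Metric.isClosed_cthickening.measurableSet)
    (measurableSet_le (by fun_prop) measurable_const)
    (fun x hx => Metric.mem_cthickening_of_dist_le _ m _ _ hm (by rwa [dist_eq_norm]))
    (by positivity) (fun x hx => ?_) (fun x hx => ?_) hpos
  · have hul : Real.exp (-(n * (lam m - ε * ‖lam‖))) / c ^ n =
        Real.exp (2 * n * ε * ‖lam‖) * (Real.exp (-(n * (lam m + ε * ‖lam‖))) / c ^ n) := by
      rw [mul_div_assoc', ← Real.exp_add]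
      congr 2
      ring
    have hl : Real.exp (-(n * (lam m + ε * ‖lam‖))) / c ^ n ≠ 0 := by positivity
    rw [hul, mul_comm (Real.exp (2 * n * ε * ‖lam‖)), mul_div_mul_left _ _ hl] at key
    exact key
  · have := sub_mul_norm_le_of_mem_cthickening hle hx hε
    rw [hW]
    gcongr
  · have hx : ‖sampleMean F x - m‖ ≤ ε := hx
    have h1 := (Real.le_norm_self _).trans (lam.le_opNorm (sampleMean F x - m))
    have h2 := mul_le_mul_of_nonneg_left hx (norm_nonneg lam)
    rw [map_sub] at h1
    rw [hW]
    gcongr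
    linarith

end Conditioning

/-! ### The sample mean under the tilted law -/

section SmallBallSample

variable {E : Type u} [MeasurableSpace E] {B : Type v} [NormedAddCommGroup B] [NormedSpace ℝ B]
  [CompleteSpace B] [MeasurableSpace B] [BorelSpace B] [SecondCountableTopology B]

/-- The small ball estimate for the centered law of `F` on the sequence space of `B`, transferred to
samples from `β`. -/
lemma eventually_exp_le_prob_sampleMean {a : ℝ} (ha : IsTypeTwoWith B a) {β : Measure E}
    [IsProbabilityMeasure β] {F : E → B} (hF : Measurable F) (hF2 : MemLp F 2 β)
    {ε : ℕ → ℝ}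
    (hε : ∀ n : ℕ, 1 ≤ n → Real.sqrt (a * vectorVariance F β) / Real.sqrt n < ε n)
    {δ : ℝ} (hδ : 0 < δ) :
    ∀ᶠ n : ℕ in atTop, Real.exp (-(δ * n)) ≤ (Measure.pi fun _ : Fin n => β).real
      {x | ‖sampleMean F x - ∫ y, F y ∂β‖ ≤ ε n} := by
  set m := ∫ y, F y ∂β with hm
  have hg : Measurable fun x => F x - m := by fun_prop
  set ρ := β.map fun x => F x - m with hρ
  have : IsProbabilityMeasure ρ := Measure.isProbabilityMeasure_map hg.aemeasurable
  have hρ2 : MemLp id 2 ρ :=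
    (memLp_map_measure_iff measurable_id.aestronglyMeasurable hg.aemeasurable).2
      (hF2.sub (memLp_const m))
  have hmean : ∫ x, x ∂ρ = 0 := by
    rw [hρ, integral_map hg.aemeasurable measurable_id'.aestronglyMeasurable,
      integral_sub (hF2.integrable one_le_two) (integrable_const _)]
    simp [hm]
  have hvar : ∫ x, ‖x‖ ^ 2 ∂ρ = vectorVariance F β := by
    rw [hρ, integral_map hg.aemeasurable (by fun_prop : Measurable _).aestronglyMeasurable]
    rfl
  filter_upwards [eventually_exp_le_prob_norm_sum_le ha hρ2 hmean hδ, eventually_ge_atTop 1]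
    with n hn hn1
  refine hn.trans ?_
  rw [hvar]
  set r := Real.sqrt (a * vectorVariance F β) * Real.sqrt n with hr
  have hD : MeasurableSet {y : Fin n → B | ‖∑ i, y i‖ ≤ r} :=
    measurableSet_le (by fun_prop) measurable_const
  have hlaw1 : (Measure.infinitePi fun _ : ℕ => ρ).map (fun ω (i : Fin n) => ω i) =
      Measure.pi fun _ : Fin n => ρ := by
    rw [← Measure.infinitePi_eq_pi]
    exact Measure.map_infinitePi_infinitePi_of_inj (P := fun _ : ℕ => ρ) Fin.val_injective
  have hlaw2 : (Measure.pi fun _ : Fin n => β).map (fun x i => F (x i) - m) =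
      Measure.pi fun _ : Fin n => ρ :=
    Measure.pi_map_pi fun _ => hg.aemeasurable
  have h1 : (Measure.infinitePi fun _ : ℕ => ρ).real
      {ω | ‖∑ i ∈ Finset.range n, ω i‖ ≤ r} =
      (Measure.pi fun _ : Fin n => β).real {x | ‖∑ i, (F (x i) - m)‖ ≤ r} := by
    have e1 := congrArg (fun μ => μ.real {y : Fin n → B | ‖∑ i, y i‖ ≤ r}) (hlaw1.trans hlaw2.symm)
    rw [map_measureReal_apply (by fun_prop) hD, map_measureReal_apply (by fun_prop) hD] at e1
    have e2 : (fun (ω : ℕ → B) (i : Fin n) => ω i) ⁻¹' {y : Fin n → B | ‖∑ i, y i‖ ≤ r} =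
        {ω | ‖∑ i ∈ Finset.range n, ω i‖ ≤ r} := by
      ext ω
      simp [← Fin.sum_univ_eq_sum_range fun i => ω i]
    rw [e2] at e1
    exact e1
  rw [h1]
  refine measureReal_mono fun x hx => ?_
  have hx : ‖∑ i, (F (x i) - m)‖ ≤ r := hx
  have hnpos : (0 : ℝ) < n := by exact_mod_cast hn1
  show ‖sampleMean F x - m‖ ≤ ε n
  rw [sampleMean_sub_const F m hn1, norm_smul, norm_inv, Real.norm_of_nonneg hnpos.le,
    inv_mul_le_iff₀ hnpos]
  refine hx.trans ?_
  have h2 := mul_le_mul_of_nonneg_left (hε n hn1).le hnpos.le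
  refine le_trans (le_of_eq ?_) h2
  have h3 : 0 < Real.sqrt n := Real.sqrt_pos.2 hnpos
  rw [hr]
  field_simp
  rw [Real.sq_sqrt hnpos.le]

end SmallBallSample

/-! ### Total variation of marginals -/

section TotalVariation

lemma totalVariationDist_nonneg {S : Type*} [MeasurableSpace S] (μ ν : Measure S) :
    0 ≤ totalVariationDist μ ν :=
  Real.iSup_nonneg fun _ => abs_nonneg _

/-- For probability measures a one-sided bound on all events suffices, by passing to
complements. -/
lemma totalVariationDist_le {S : Type*} [MeasurableSpace S] {μ ν : Measure S}
    [IsProbabilityMeasure μ] [IsProbabilityMeasure ν] {η : ℝ}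
    (h : ∀ A, MeasurableSet A → μ.real A - ν.real A ≤ η) : totalVariationDist μ ν ≤ η := by
  have : Nonempty {A : Set S // MeasurableSet A} := ⟨⟨∅, MeasurableSet.empty⟩⟩
  refine ciSup_le fun A => abs_sub_le_iff.2 ⟨h A.1 A.2, ?_⟩
  have := h _ A.2.compl
  rw [probReal_compl_eq_one_sub A.2, probReal_compl_eq_one_sub A.2] at this
  linarith

/-- The quantitative form of conditional convergence: a product density bound that is
subexponential in `n` makes the `k`-dimensional marginal of a permutation invariant law close
to `β^k`. -/
lemma totalVariationDist_marginal_le {E : Type*} [MeasurableSpace E] {β : Measure E}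
    [IsProbabilityMeasure β] {n k : ℕ} {ν : Measure (Fin n → E)} [IsProbabilityMeasure ν]
    (hν : ∀ σ : Equiv.Perm (Fin n), ν.map (fun x i => x (σ i)) = ν) {M : ℝ}
    (hM : ν ≤ ENNReal.ofReal M • Measure.pi fun _ : Fin n => β) (hk : 0 < k) (hkn : k ≤ n)
    {η : ℝ} (hη : 0 < η) (hlog : Real.log M ≤ η ^ 2 / k * n) :
    totalVariationDist (ν.map fun x (i : Fin k) => x (Fin.castLE hkn i))
      (Measure.pi fun _ : Fin k => β) ≤ η := by
  have : IsProbabilityMeasure (ν.map fun x (i : Fin k) => x (Fin.castLE hkn i)) :=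
    Measure.isProbabilityMeasure_map (by fun_prop : Measurable _).aemeasurable
  have hq : 0 < n / k := Nat.div_pos hkn hk
  refine totalVariationDist_le fun A hA => ?_
  refine (real_marginal_sub_le hν hM hq (Nat.div_mul_le_self n k) hkn hA
    (by positivity : 0 < 4 * η)).trans ?_
  have hkpos : (0 : ℝ) < k := by exact_mod_cast hk
  have hqpos : (0 : ℝ) < (n / k : ℕ) := by exact_mod_cast hq
  -- at least half of the coordinates are covered by the `n / k` blocks
  have hn : (n : ℝ) ≤ 2 * k * (n / k : ℕ) := by
    have h1 := Nat.div_add_mod n k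
    have h2 := Nat.mod_lt n hk
    have h3 : k * 1 ≤ k * (n / k) := Nat.mul_le_mul_left k hq
    have : n ≤ 2 * (k * (n / k)) := by omega
    calc (n : ℝ) ≤ (2 * (k * (n / k)) : ℕ) := by exact_mod_cast this
      _ = _ := by push_cast; ring
  have h4 : Real.log M / (4 * η * (n / k : ℕ)) ≤ η / 2 := by
    rw [div_le_iff₀ (by positivity)]
    refine hlog.trans ?_
    calc η ^ 2 / k * n ≤ η ^ 2 / k * (2 * k * (n / k : ℕ)) := by gcongr
      _ = _ := by field_simp; ring
  linarith

end TotalVariation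

/-! ### Convergence of the conditional laws -/

section Convergence

/-- Conditional convergence with the optimality of `lam` in the form in which it is used: the tilted
mean lies in `K` and minimizes `⟨lam, ·⟩` over `K`. -/
lemma conditionalLaw_tendsto
    {E : Type u} [MeasurableSpace E]
    {B : Type v} [NormedAddCommGroup B] [NormedSpace ℝ B] [CompleteSpace B]
    [MeasurableSpace B] [BorelSpace B] [SecondCountableTopology B]
    {α : Measure E} [IsProbabilityMeasure α] {F : E → B} (hF : Measurable F)
    {a : ℝ} (ha : IsTypeTwoWith B a) {K : Set B} {lam : StrongDual ℝ B}
    (hint : Integrable (fun x => Real.exp (lam (F x))) α)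
    (hF2 : MemLp F 2 (α.tilted fun x => lam (F x)))
    (hmem : ∫ x, F x ∂(α.tilted fun x => lam (F x)) ∈ K)
    (hle : ∀ y ∈ K, lam (∫ x, F x ∂(α.tilted fun x => lam (F x))) ≤ lam y)
    {ε : ℕ → ℝ} (hε0 : Tendsto ε atTop (𝓝 0))
    (hε : ∀ n : ℕ, 1 ≤ n →
      Real.sqrt (a * vectorVariance F (α.tilted fun x => lam (F x))) / Real.sqrt n < ε n)
    {Ω : Type*} [MeasurableSpace Ω] {P : Measure Ω} [IsProbabilityMeasure P] {X : ℕ → Ω → E}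
    (hX : ∀ i, Measurable (X i)) (hindep : iIndepFun X P) (hlaw : ∀ i, P.map (X i) = α) :
    (∀ᶠ n : ℕ in atTop,
      0 < P (empiricalEvent X n (momentConstraint F (Metric.cthickening (ε n) K)))) ∧
    ∀ k : ℕ, 1 ≤ k →
      Tendsto (fun n : ℕ => totalVariationDist
          (conditionalLaw P X n k (momentConstraint F (Metric.cthickening (ε n) K)))
          (Measure.pi fun _ : Fin k => α.tilted fun x => lam (F x)))
        atTop (𝓝 0) := by
  set β := α.tilted fun x => lam (F x) with hβ
  have : IsProbabilityMeasure β := isProbabilityMeasure_tilted hint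
  set m := ∫ x, F x ∂β
  have hεpos : ∀ n : ℕ, 1 ≤ n → 0 ≤ ε n := fun n hn =>
    (by positivity : (0 : ℝ) ≤ _ / _).trans (hε n hn).le
  have hC : ∀ n, MeasurableSet (Metric.cthickening (ε n) K) := fun n =>
    Metric.isClosed_cthickening.measurableSet
  have hball := fun δ : ℝ => eventually_exp_le_prob_sampleMean ha hF hF2 hε (δ := δ)
  refine ⟨?_, fun k hk => ?_⟩
  · filter_upwards [hball 1 one_pos, eventually_ge_atTop 1] with n hn hn1
    rw [(conditionalLaw_eq hF (hC n) hX hindep hlaw hn1).1]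
    exact (cond_sampleMean_le hF hint hmem hle (hεpos n hn1) hn1
      ((Real.exp_pos _).trans_le hn)).1
  · refine Metric.tendsto_nhds.2 fun η' hη' => ?_
    obtain ⟨η, hη, hηη'⟩ := exists_between hη'
    have hkpos : (0 : ℝ) < k := by exact_mod_cast hk
    set δ := η ^ 2 / k / 2 with hδdef
    have hδ : 0 < δ := by positivity
    have hεsmall : ∀ᶠ n in atTop, 2 * ε n * ‖lam‖ < δ := by
      have : Tendsto (fun n => 2 * ε n * ‖lam‖) atTop (𝓝 (2 * 0 * ‖lam‖)) :=
        (hε0.const_mul 2).mul_const _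
      rw [mul_zero, zero_mul] at this
      exact this.eventually_lt_const hδ
    filter_upwards [hball δ hδ, hεsmall, eventually_ge_atTop 1, eventually_ge_atTop k]
      with n hn hεn hn1 hkn
    set g := (Measure.pi fun _ : Fin n => β).real {x | ‖sampleMean F x - m‖ ≤ ε n} with hg
    have hgpos : 0 < g := (Real.exp_pos _).trans_le hn
    obtain ⟨hApos, hAle⟩ := cond_sampleMean_le hF hint hmem hle (hεpos n hn1) hn1 hgpos
    rw [Real.dist_eq, sub_zero, abs_of_nonneg (totalVariationDist_nonneg _ _)]
    refine lt_of_le_of_lt ?_ hηη'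
    rw [(conditionalLaw_eq hF (hC n) hX hindep hlaw hn1).2 k hkn]
    have hprob := cond_isProbabilityMeasure hApos.ne'
    refine totalVariationDist_marginal_le (fun σ => ?_) hAle hk hkn hη ?_
    · have hA : MeasurableSet {x : Fin n → E | sampleMean F x ∈ Metric.cthickening (ε n) K} :=
        measurable_sampleMean hF n (hC n)
      have hpre : (fun (x : Fin n → E) i => x (σ i)) ⁻¹'
          {x | sampleMean F x ∈ Metric.cthickening (ε n) K} =
          {x | sampleMean F x ∈ Metric.cthickening (ε n) K} := by
        ext x
        simp [sampleMean_comp_perm F σ x]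
      have := map_cond_preimage (P := Measure.pi fun _ : Fin n => α)
        (by fun_prop : Measurable fun (x : Fin n → E) i => x (σ i)) hA
      rwa [hpre, map_pi_comp_injective α σ.injective] at this
    · rw [Real.log_div (Real.exp_pos _).ne' hgpos.ne', Real.log_exp]
      have h1 := Real.log_le_log (Real.exp_pos _) hn
      rw [Real.log_exp] at h1
      have h2 := mul_le_mul_of_nonneg_right hεn.le (Nat.cast_nonneg (α := ℝ) n)
      have h3 : η ^ 2 / k = 2 * δ := by rw [hδdef]; ring
      rw [h3]
      linarith

end Convergence

theorem theorem3p4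
    {E : Type u} [TopologicalSpace E] [PolishSpace E] [MeasurableSpace E] [BorelSpace E]
    {B : Type v} [NormedAddCommGroup B] [NormedSpace ℝ B] [CompleteSpace B]
    [TopologicalSpace.SeparableSpace B] [MeasurableSpace B] [BorelSpace B]
    (α : Measure E) [IsProbabilityMeasure α]
    (F : E → B) (hF : Measurable F) (hFtau : MemLtau α (fun x => ‖F x‖))
    (hdom_ne : (domLogLaplace α F).Nonempty) (hdom : IsOpen (domLogLaplace α F))
    (a : ℝ) (ha : IsTypeTwoWith B a)
    (K : Set B) (hKne : K.Nonempty) (hKclosed : IsClosed K) (hKconv : Convex ℝ K)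
    -- (H-K): the functional attains its minimum at `lamStar`
    (lamStar : StrongDual ℝ B)
    (hmin : ∀ lam : StrongDual ℝ B, dualFunctional α F K lamStar ≤ dualFunctional α F K lam) :
    -- `α.tilted (⟨lamStar, F⟩)` is the measure `exp ⟨lamStar, F⟩ / Z_F(lamStar) α`
    IsIProjection α (momentConstraint F K) (α.tilted (fun x => lamStar (F x))) ∧
    ∀ ε : ℕ → ℝ, Tendsto ε atTop (𝓝 0) →
      (∀ n : ℕ, 1 ≤ n →
        Real.sqrt (a * vectorVariance F (α.tilted (fun x => lamStar (F x)))) / Real.sqrt n < ε n) →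
      ∀ (Ω : Type*) [MeasurableSpace Ω] (P : Measure Ω) [IsProbabilityMeasure P]
        (X : ℕ → Ω → E), (∀ i, Measurable (X i)) → iIndepFun X P → (∀ i, P.map (X i) = α) →
        (∀ᶠ n : ℕ in atTop,
          0 < P (empiricalEvent X n (momentConstraint F (Metric.cthickening (ε n) K)))) ∧
        ∀ k : ℕ, 1 ≤ k →
          Tendsto (fun n : ℕ =>
              totalVariationDist
                (conditionalLaw P X n k (momentConstraint F (Metric.cthickening (ε n) K)))
                (Measure.pi (fun _ : Fin k => α.tilted (fun x => lamStar (F x)))))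
            atTop (𝓝 0) := by
  have : SecondCountableTopology B := UniformSpace.secondCountable_of_separable B
  have hint := (dualFunctional_minimizer hF hKne hmin).1
  obtain ⟨hmem, hle⟩ := tilted_mean_optimality hF hFtau hdom hKne hKclosed hKconv hmin
  have hF2 := memLp_two_tilted hF hFtau hdom hint
  have : IsProbabilityMeasure (α.tilted fun x => lamStar (F x)) := isProbabilityMeasure_tilted hint
  refine ⟨isIProjection_tilted hint (hF2.integrable one_le_two) hmem hle, ?_⟩
  intro ε hε0 hε Ω _ P _ X hX hindep hlaw
  exact conditionalLaw_tendsto hF ha hint hF2 hmem hle hε0 hε hX hindep hlaw
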